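/- Let $1<p<\infty$, let $n\ge 0$ be an integer, and let $G$ be a (discrete) group. Let $\ell^p(G)$ be the Banach space of $p$-summable functions $G\to\mathbb C$, regarded as a left $\mathbb Z[G]$-module by $(gf)(h)=f(g^{-1}h)$. Recall that $G$ is of type $FP_n$ if there is a partial resolution $F_n\to\dots\to F_0\to\mathbb Z\to 0$ of the trivial $\mathbb Z[G]$-module $\mathbb Z$ by finitely generated projective $\mathbb Z[G]$-modules. For a projective resolution $\dots\to F_2\xrightarrow{\partial_2}F_1\xrightarrow{\partial_1}F_0\to\mathbb Z\to0$ of $\mathbb Z$ over $\mathbb Z[G]$ in which $F_0,\dots,F_n$ are finitely generated, and for $0\le i\le n$, define the reduced $\ell^p$-homology and the reduced $\ell^p$-cohomology of $G$ by $$\overline{H^{(p)}_i(G)}=\ker(\partial_i\otimes 1)\big/\overline{\operatorname{im}(\partial_{i+1}\otimes 1)},\qquad \overline{H_{(p)}^i(G)}=\ker(\widetilde\partial_{i+1})\big/\overline{\operatorname{im}(\widetilde\partial_i)},$$ where $\partial_i\otimes 1$ are the boundary maps of $F_*\otimes_{\mathbb Z[G]}\ell^p(G)$, where $\widetilde\partial_i(\varphi)=\varphi\circ\partial_i$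 on $\operatorname{Hom}_{\mathbb Z[G]}(F_*,\ell^p(G))$, and where $\partial_0\otimes 1=0$ and $\widetilde\partial_0=0$. The closures are taken in $F_i\otimes_{\mathbb Z[G]}\ell^p(G)$ and $\operatorname{Hom}_{\mathbb Z[G]}(F_i,\ell^p(G))$ with their natural topologies, as direct summands of some $\ell^p(G)^m$ (recall that $F_i$ is finitely generated projective for $i\le n$). Suppose that $G$ is of type $FP_n$ and that the center of $G$ contains an element of infinite order. Then, for every such resolution, $$\overline{H^{(p)}_i(G)}=0\quad\text{and}\quad\overline{H_{(p)}^i(G)}=0\qquad\text{for all } 0\le i\le n.$$ -/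

import Mathlib

open scoped ENNReal TensorProduct

universe u v

noncomputable section

namespace LpHomology

/-- The integral group ring `ℤ[G]`. -/
abbrev ZG (G : Type u) [Group G] : Type u := MonoidAlgebra ℤ G

/-! ### Augmented sequences, projective resolutions, and the finiteness property `FP_n` -/

/-- A sequence `⋯ → F 2 → F 1 → F 0 → ℤ` of left `ℤ[G]`-modules and `ℤ[G]`-linear maps, where `ℤ`
carries the trivial action of `G`.  No exactness is imposed here. -/
structure AugSeq (G : Type u) [Group G] where
  F : ℕ → Type v
  [addCommGroup : ∀ i, AddCommGroup (F i)]
  [module : ∀ i, Module (ZG G) (F i)]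
  /-- the boundary map `∂_{i+1} : F (i+1) → F i` -/
  d : ∀ i, F (i + 1) →ₗ[ZG G] F i
  /-- the augmentation -/
  ε : F 0 →+ ℤ
  ε_smul : ∀ (g : G) (x : F 0), ε (MonoidAlgebra.of ℤ G g • x) = ε x

attribute [instance] AugSeq.addCommGroup AugSeq.module

/-- The sequence is a projective resolution of the trivial module `ℤ` over `ℤ[G]`. -/
structure AugSeq.IsProjectiveResolution {G : Type u} [Group G] (A : AugSeq.{u, v} G) : Prop where
  projective : ∀ i, Module.Projective (ZG G) (A.F i)
  surjective : Function.Surjective A.ε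
  exact_zero : Function.Exact (A.d 0) A.ε
  exact_succ : ∀ i, Function.Exact (A.d (i + 1)) (A.d i)

/-- The part `F n → ⋯ → F 0 → ℤ → 0` of the sequence is a partial projective resolution of the
trivial module `ℤ` (it is exact at `F (n-1), …, F 0` and at `ℤ`). The terms beyond `F n` play no
role. -/
structure AugSeq.IsPartialProjectiveResolution {G : Type u} [Group G] (A : AugSeq.{u, v} G)
    (n : ℕ) : Prop where
  projective : ∀ i ≤ n, Module.Projective (ZG G) (A.F i)
  surjective : Function.Surjective A.ε
  exact_zero : 0 < n → Function.Exact (A.d 0) A.ε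
  exact_succ : ∀ i, i + 1 < n → Function.Exact (A.d (i + 1)) (A.d i)

/-- The modules `F 0, …, F n` are finitely generated. -/
def AugSeq.IsFiniteTypeUpTo {G : Type u} [Group G] (A : AugSeq.{u, v} G) (n : ℕ) : Prop :=
  ∀ i ≤ n, Module.Finite (ZG G) (A.F i)

/-- `G` is of type `FP_n`. -/
def IsTypeFP (G : Type u) [Group G] (n : ℕ) : Prop :=
  ∃ A : AugSeq.{u, u} G, A.IsPartialProjectiveResolution n ∧ A.IsFiniteTypeUpTo n

/-! ### The `ℤ[G]`-module `ℓ^p(G)` -/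

/-- The space `ℓ^p(G)` of `p`-summable complex functions on `G`. -/
abbrev Lp (G : Type u) (p : ℝ≥0∞) : Type u := lp (fun _ : G => ℂ) p

theorem memLp_translate {G : Type u} [Group G] {p : ℝ≥0∞} (g : G) {f : G → ℂ}
    (hf : Memℓp f p) : Memℓp (fun h => f (g⁻¹ * h)) p := by
  rcases p.trichotomy with rfl | rfl | hp
  · rw [memℓp_zero_iff] at hf ⊢
    exact hf.preimage (mul_right_injective g⁻¹).injOn
  · rw [memℓp_infty_iff] at hf ⊢
    refine hf.mono ?_
    rintro _ ⟨h, rfl⟩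
    exact ⟨g⁻¹ * h, rfl⟩
  · rw [memℓp_gen_iff hp] at hf ⊢
    exact hf.comp_injective (mul_right_injective g⁻¹)

/-- The left translation action of `G` on `ℓ^p(G)`, `(g f)(h) = f (g⁻¹ h)`; on formal sums,
`g (∑ f_h h) = ∑ f_h (g h)`. -/
def lpTranslate (G : Type u) [Group G] (p : ℝ≥0∞) : G →* Module.End ℤ (Lp G p) where
  toFun g := AddMonoidHom.toIntLinearMap
    { toFun := fun f => ⟨fun h => f (g⁻¹ * h), memLp_translate g f.2⟩
      map_zero' := rfl
      map_add' := fun _ _ => rfl }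
  map_one' := by
    ext f h
    simp
  map_mul' a b := by
    ext f h
    change f ((a * b)⁻¹ * h) = f (b⁻¹ * (a⁻¹ * h))
    rw [mul_inv_rev, mul_assoc]

/-- `ℓ^p(G)` as a left `ℤ[G]`-module. -/
instance lpModule (G : Type u) [Group G] (p : ℝ≥0∞) : Module (ZG G) (Lp G p) :=
  Module.compHom (Lp G p) (MonoidAlgebra.lift ℤ (Module.End ℤ (Lp G p)) G (lpTranslate G p)).toRingHom

theorem of_smul_apply {G : Type u} [Group G] {p : ℝ≥0∞} (g : G) (f : Lp G p) (h : G) :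
    (MonoidAlgebra.of ℤ G g • f) h = f (g⁻¹ * h) := by
  change (MonoidAlgebra.lift ℤ (Module.End ℤ (Lp G p)) G (lpTranslate G p)
    (MonoidAlgebra.of ℤ G g) f) h = _
  rw [MonoidAlgebra.lift_of]
  rfl

section Complexes

variable (G : Type u) [Group G] (p : ℝ≥0∞)

/-! ### The tensor product `F ⊗_{ℤ[G]} ℓ^p(G)` -/

/-- The relations `x g ⊗ f = x ⊗ g f`, where a left `ℤ[G]`-module `F` is regarded as a right module
in the usual way, `x g = g⁻¹ x`. -/
def tensorRel (F : Type v) [AddCommGroup F] [Module (ZG G) F] : AddSubgroup (F ⊗[ℤ] Lp G p) :=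
  AddSubgroup.closure {z | ∃ (g : G) (x : F) (f : Lp G p),
    z = (MonoidAlgebra.of ℤ G g⁻¹ • x) ⊗ₜ[ℤ] f - x ⊗ₜ[ℤ] (MonoidAlgebra.of ℤ G g • f)}

/-- `F ⊗_{ℤ[G]} ℓ^p(G)`. -/
def LpChain (F : Type v) [AddCommGroup F] [Module (ZG G) F] : Type (max u v) :=
  (F ⊗[ℤ] Lp G p) ⧸ tensorRel G p F

instance (F : Type v) [AddCommGroup F] [Module (ZG G) F] : AddCommGroup (LpChain G p F) :=
  inferInstanceAs (AddCommGroup ((F ⊗[ℤ] Lp G p) ⧸ tensorRel G p F))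

variable {G} {F F' : Type v} [AddCommGroup F] [Module (ZG G) F] [AddCommGroup F'] [Module (ZG G) F']

/-- The elementary tensor `x ⊗ f` in `F ⊗_{ℤ[G]} ℓ^p(G)`. -/
def LpChain.tmul (x : F) (f : Lp G p) : LpChain G p F :=
  QuotientAddGroup.mk' (tensorRel G p F) (x ⊗ₜ[ℤ] f)

/-- The map `φ ⊗ 1 : F ⊗_{ℤ[G]} ℓ^p(G) → F' ⊗_{ℤ[G]} ℓ^p(G)`. -/
def LpChain.map (φ : F →ₗ[ZG G] F') : LpChain G p F →+ LpChain G p F' :=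
  QuotientAddGroup.map (tensorRel G p F) (tensorRel G p F')
    (TensorProduct.map (φ.toAddMonoidHom.toIntLinearMap)
      (LinearMap.id : Lp G p →ₗ[ℤ] Lp G p)).toAddMonoidHom
    (by
      rw [tensorRel, AddSubgroup.closure_le]
      rintro _ ⟨g, x, f, rfl⟩
      refine AddSubgroup.subset_closure ⟨g, φ x, f, ?_⟩
      simp)

theorem LpChain.map_tmul (φ : F →ₗ[ZG G] F') (x : F) (f : Lp G p) :
    LpChain.map p φ (LpChain.tmul p x f) = LpChain.tmul p (φ x) f := rfl

/-! ### The topologies -/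

/-- The natural topology on `F ⊗_{ℤ[G]} ℓ^p(G)`: the finest group topology for which all the maps
`ℓ^p(G) → F ⊗_{ℤ[G]} ℓ^p(G)`, `f ↦ x ⊗ f`, are continuous.  If `x_1, …, x_m` generate `F`, it is
the quotient topology under the surjection `ℓ^p(G)^m → F ⊗_{ℤ[G]} ℓ^p(G)`,
`(f_j) ↦ ∑ x_j ⊗ f_j`; so it is the norm topology of `ℓ^p(G)^m` if `F` is free of rank `m`, and the
one of a direct summand of `ℓ^p(G)^m` if `F` is finitely generated projective. -/
def LpChain.groupTopology [Fact (1 ≤ p)] (F : Type v) [AddCommGroup F] [Module (ZG G) F] :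
    AddGroupTopology (LpChain G p F) :=
  sInf {t | ∀ x : F, @Continuous _ _ _ t.toTopologicalSpace
    (fun f : Lp G p => LpChain.tmul p x f)}

instance [Fact (1 ≤ p)] : TopologicalSpace (LpChain G p F) :=
  (LpChain.groupTopology p F).toTopologicalSpace

instance [Fact (1 ≤ p)] : IsTopologicalAddGroup (LpChain G p F) :=
  (LpChain.groupTopology p F).toIsTopologicalAddGroup

variable (G) in
/-- `Hom_{ℤ[G]}(F, ℓ^p(G))`. -/
def LpCochain (F : Type v) [AddCommGroup F] [Module (ZG G) F] : Type (max u v) :=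
  F →ₗ[ZG G] Lp G p

instance : AddCommGroup (LpCochain G p F) := inferInstanceAs (AddCommGroup (F →ₗ[ZG G] Lp G p))

/-- The underlying function of a cochain. -/
def LpCochain.toFun : LpCochain G p F →+ (F → Lp G p) where
  toFun φ := fun x => (show F →ₗ[ZG G] Lp G p from φ) x
  map_zero' := rfl
  map_add' _ _ := rfl

/-- The dual map `φ ↦ φ ∘ ∂` of `∂ : F → F'`. -/
def LpCochain.comap (φ : F →ₗ[ZG G] F') : LpCochain G p F' →+ LpCochain G p F where
  toFun ψ := (show F' →ₗ[ZG G] Lp G p from ψ).comp φ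
  map_zero' := rfl
  map_add' _ _ := rfl

/-- The natural topology on `Hom_{ℤ[G]}(F, ℓ^p(G))`: that of convergence at every point of `F` in
the norm of `ℓ^p(G)`.  If `x_1, …, x_m` generate `F`, it is the topology induced by the embedding
`φ ↦ (φ x_1, …, φ x_m)` into `ℓ^p(G)^m`, which is bijective if the `x_j` form a basis. -/
instance [Fact (1 ≤ p)] : TopologicalSpace (LpCochain G p F) :=
  TopologicalSpace.induced (LpCochain.toFun p) inferInstance

instance [Fact (1 ≤ p)] : IsTopologicalAddGroup (LpCochain G p F) :=
  topologicalAddGroup_induced (LpCochain.toFun p)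

end Complexes

/-! ### Reduced `ℓ^p`-homology and `ℓ^p`-cohomology -/

section Homology

variable {G : Type u} [Group G] (A : AugSeq.{u, v} G) (p : ℝ≥0∞)

/-- `ker (∂_i ⊗ 1)`, with `∂_0 = 0`. -/
def cycles : ∀ i, AddSubgroup (LpChain G p (A.F i))
  | 0 => ⊤
  | i + 1 => (LpChain.map p (A.d i)).ker

/-- `im (∂_{i+1} ⊗ 1)`. -/
def boundaries (i : ℕ) : AddSubgroup (LpChain G p (A.F i)) := (LpChain.map p (A.d i)).range

/-- The kernel of `φ ↦ φ ∘ ∂_{i+1}`. -/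
def cocycles (i : ℕ) : AddSubgroup (LpCochain G p (A.F i)) := (LpCochain.comap p (A.d i)).ker

/-- The image of `φ ↦ φ ∘ ∂_i`, with `∂_0 = 0`. -/
def coboundaries : ∀ i, AddSubgroup (LpCochain G p (A.F i))
  | 0 => ⊥
  | i + 1 => (LpCochain.comap p (A.d i)).range

/-- The reduced `ℓ^p`-homology in degree `i`, computed with the resolution `A`: the kernel of
`∂_i ⊗ 1` modulo the closure of the image of `∂_{i+1} ⊗ 1`. -/
def ReducedHomology [Fact (1 ≤ p)] (i : ℕ) : Type (max u v) :=
  cycles A p i ⧸ (boundaries A p i).topologicalClosure.addSubgroupOf (cycles A p i)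

instance [Fact (1 ≤ p)] (i : ℕ) : AddCommGroup (ReducedHomology A p i) :=
  inferInstanceAs (AddCommGroup
    (cycles A p i ⧸ (boundaries A p i).topologicalClosure.addSubgroupOf (cycles A p i)))

/-- The reduced `ℓ^p`-cohomology in degree `i`, computed with the resolution `A`: the kernel of the
dual map of `∂_{i+1}` modulo the closure of the image of the dual map of `∂_i`. -/
def ReducedCohomology [Fact (1 ≤ p)] (i : ℕ) : Type (max u v) :=
  cocycles A p i ⧸ (coboundaries A p i).topologicalClosure.addSubgroupOf (cocycles A p i)

instance [Fact (1 ≤ p)] (i : ℕ) : AddCommGroup (ReducedCohomology A p i) :=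
  inferInstanceAs (AddCommGroup
    (cocycles A p i ⧸ (coboundaries A p i).topologicalClosure.addSubgroupOf (cocycles A p i)))

end Homology

end LpHomology

end

/-!
Let `z` be a central element of infinite order.  Two facts together give the vanishing.

* For a central `w`, multiplication by `w` is an endomorphism of the resolution that lifts the
  identity of `ℤ`, so it is chain homotopic to the identity
  (`AugSeq.IsProjectiveResolution.exists_homotopy_succ`).  Hence `w` acts trivially on the unreduced
  homology and cohomology with coefficients in `ℓ^p(G)`.
* The Cesàro means `A_N = N⁻¹ ∑_{k < N} z ^ k` tend strongly to `0` on `ℓ^p(G)`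
  (`tendsto_cesaro`): they are contractions, and on a point mass the norm of `A_N` is
  `N ^ (1 / p - 1)`, because the points `z ^ k h` are distinct.  This uses `1 < p < ∞`.

If `c` is a cycle, then by the first fact `c - A_N c`, the sum over `k < N` of the differences
`N⁻¹ c - z ^ k N⁻¹ c`, is a boundary.  By the second fact `A_N c` tends to `0`, so `c` is a limit
of boundaries.  The same argument applies to cocycles.  In both cases the topology enters only
through the continuity of `f ↦ x ⊗ f` and through pointwise convergence of cochains.
-/

noncomputable section

namespace LpHomology

/-! ### Multiplication by a central group element -/

section Central

variable {G : Type u} [Group G]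

/-- Multiplication by a central element `w` of `G`, as a `ℤ[G]`-linear endomorphism. -/
def centralSMul {w : G} (hw : w ∈ Subgroup.center G) (F : Type*) [AddCommGroup F]
    [Module (ZG G) F] : F →ₗ[ZG G] F where
  toFun x := MonoidAlgebra.of ℤ G w • x
  map_add' := smul_add _
  map_smul' r x := by
    have h : Commute (MonoidAlgebra.of ℤ G w) r :=
      MonoidAlgebra.of_commute (fun m => (Subgroup.mem_center_iff.mp hw m).symm) r
    rw [smul_smul, h.eq, ← smul_smul, RingHom.id_apply]

@[simp]
theorem centralSMul_apply {w : G} (hw : w ∈ Subgroup.center G) {F : Type*} [AddCommGroup F]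
    [Module (ZG G) F] (x : F) : centralSMul hw F x = MonoidAlgebra.of ℤ G w • x := rfl

/-- A map out of a projective module lifts along `g` if it is killed by a map `k` such that
`ker k = im g`. -/
theorem exists_lift_of_exact {R P M N K : Type*} [Ring R] [AddCommGroup P] [Module R P]
    [Module.Projective R P] [AddCommGroup M] [Module R M] [AddCommGroup N] [Module R N] [Zero K]
    {g : M →ₗ[R] N} {k : N → K} (hgk : Function.Exact g k) (f : P →ₗ[R] N)
    (hf : ∀ x, k (f x) = 0) : ∃ h : P →ₗ[R] M, ∀ x, g (h x) = f x := by
  obtain ⟨h, hh⟩ := Module.projective_lifting_property g.rangeRestrict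
    (f.codRestrict (LinearMap.range g) fun x => (hgk (f x)).mp (hf x)) g.surjective_rangeRestrict
  exact ⟨h, fun x => congrArg Subtype.val (LinearMap.congr_fun hh x)⟩

variable {A : AugSeq.{u, v} G} {w : G}

theorem AugSeq.IsProjectiveResolution.exists_homotopy_zero (hA : A.IsProjectiveResolution)
    (hw : w ∈ Subgroup.center G) :
    ∃ h : A.F 0 →ₗ[ZG G] A.F 1, ∀ x, A.d 0 (h x) = x - centralSMul hw _ x := by
  have := hA.projective 0
  exact exists_lift_of_exact hA.exact_zero (LinearMap.id - centralSMul hw _) fun x => by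
    simp [-MonoidAlgebra.of_apply, A.ε_smul]

/-- Multiplication by a central element is chain homotopic to the identity. -/
theorem AugSeq.IsProjectiveResolution.exists_homotopy_succ (hA : A.IsProjectiveResolution)
    (hw : w ∈ Subgroup.center G) (i : ℕ) :
    ∃ (h : A.F i →ₗ[ZG G] A.F (i + 1)) (h' : A.F (i + 1) →ₗ[ZG G] A.F (i + 2)),
      ∀ x, A.d (i + 1) (h' x) + h (A.d i x) = x - centralSMul hw _ x := by
  induction i with
  | zero =>
    obtain ⟨h, hh⟩ := hA.exists_homotopy_zero hw
    have := hA.projective 1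
    obtain ⟨h', hh'⟩ := exists_lift_of_exact (hA.exact_succ 0)
      (LinearMap.id - centralSMul hw _ - h ∘ₗ A.d 0) fun x => by
        simp [-MonoidAlgebra.of_apply, hh]
    exact ⟨h, h', fun x => by simp [hh']⟩
  | succ i ih =>
    obtain ⟨h, h', hh⟩ := ih
    have := hA.projective (i + 2)
    obtain ⟨h'', hh''⟩ := exists_lift_of_exact (hA.exact_succ (i + 1))
      (LinearMap.id - centralSMul hw _ - h' ∘ₗ A.d (i + 1)) fun x => by
        have h1 := hh (A.d (i + 1) x)
        rw [(hA.exact_succ i).apply_apply_eq_zero, map_zero, add_zero] at h1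
        simp [-MonoidAlgebra.of_apply, h1]
    exact ⟨h', h'', fun x => by simp [hh'']⟩

end Central

/-! ### Cesàro means on `ℓ^p(G)` -/

section Cesaro

variable {G : Type u} [Group G] {p : ℝ≥0∞}

theorem of_smul_single [DecidableEq G] (g h : G) (a : ℂ) :
    MonoidAlgebra.of ℤ G g • (lp.single p h a : Lp G p) = lp.single p (g * h) a := by
  ext x
  rw [of_smul_apply]
  simp only [lp.coeFn_single, Pi.single_apply, inv_mul_eq_iff_eq_mul]

variable (G p) in
/-- Multiplication by a complex number, as a `ℤ[G]`-linear endomorphism of `ℓ^p(G)`. -/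
def scalar (a : ℂ) : Lp G p →ₗ[ZG G] Lp G p :=
  MonoidAlgebra.equivariantOfLinearOfComm
    (AddMonoidHom.toIntLinearMap (DistribSMul.toAddMonoidHom (Lp G p) a)) fun g f => by
      ext x
      change a • (MonoidAlgebra.of ℤ G g • f) x = (MonoidAlgebra.of ℤ G g • (a • f)) x
      rw [of_smul_apply, of_smul_apply]
      rfl

@[simp]
theorem scalar_apply (a : ℂ) (f : Lp G p) : scalar G p a f = a • f := rfl

variable {z : G} (hz : z ∈ Subgroup.center G)

variable (p) in
/-- The Cesàro mean `N⁻¹ ∑_{k < N} z ^ k` on `ℓ^p(G)`; it is `0` for `N = 0`. -/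
def cesaro (N : ℕ) : Lp G p →ₗ[ZG G] Lp G p :=
  ∑ k ∈ Finset.range N, centralSMul (pow_mem hz k) (Lp G p) ∘ₗ scalar G p (N : ℂ)⁻¹

theorem cesaro_apply (N : ℕ) (f : Lp G p) :
    cesaro p hz N f = ∑ k ∈ Finset.range N, MonoidAlgebra.of ℤ G (z ^ k) • ((N : ℂ)⁻¹ • f) := by
  simp [cesaro, -MonoidAlgebra.of_apply]

variable [Fact (1 ≤ p)]

theorem norm_of_smul (hp : p ≠ ∞) (g : G) (f : Lp G p) : ‖MonoidAlgebra.of ℤ G g • f‖ = ‖f‖ := by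
  have hp0 : 0 < p.toReal :=
    ENNReal.toReal_pos (zero_lt_one.trans_le (Fact.out : 1 ≤ p)).ne' hp
  rw [lp.norm_eq_tsum_rpow hp0, lp.norm_eq_tsum_rpow hp0]
  simp only [of_smul_apply]
  exact congrArg (· ^ (1 / p.toReal))
    ((Equiv.mulLeft g⁻¹).tsum_eq fun h => ‖f h‖ ^ p.toReal)

theorem norm_cesaro_le (hp : p ≠ ∞) (N : ℕ) (f : Lp G p) : ‖cesaro p hz N f‖ ≤ ‖f‖ := by
  rw [cesaro_apply]
  refine (norm_sum_le _ _).trans ?_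
  simp only [norm_of_smul hp, norm_smul, norm_inv, RCLike.norm_natCast, Finset.sum_const,
    Finset.card_range, nsmul_eq_mul]
  rcases eq_or_ne (N : ℝ) 0 with h | h
  · simp [h]
  · rw [mul_inv_cancel_left₀ h]

/-- The points `z ^ k * h` are distinct, so the `p`-th power of the norm of the mean of `N` translates
of a point mass of weight `a` is `N * (N⁻¹ * ‖a‖) ^ p`, which is `N ^ (1 - p) * ‖a‖ ^ p`. -/
theorem tendsto_cesaro_single [DecidableEq G] (hp_one : 1 < p) (hp_top : p ≠ ∞)
    (hz_order : ¬ IsOfFinOrder z) (h : G) (a : ℂ) :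
    Filter.Tendsto (fun N => cesaro p hz N (lp.single p h a)) Filter.atTop (nhds 0) := by
  have hp1 : 1 < p.toReal := by
    rw [← ENNReal.toReal_one]
    exact (ENNReal.toReal_lt_toReal ENNReal.one_ne_top hp_top).mpr hp_one
  have hp0 : 0 < p.toReal := zero_lt_one.trans hp1
  have hinj : Function.Injective fun k : ℕ => z ^ k * h :=
    (mul_left_injective h).comp (injective_pow_iff_not_isOfFinOrder.mpr hz_order)
  have hnorm (N : ℕ) : ‖cesaro p hz N (lp.single p h a)‖ ^ p.toReal
      = N * ((N : ℝ)⁻¹ * ‖a‖) ^ p.toReal := by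
    have hsum : cesaro p hz N (lp.single p h a)
        = ∑ x ∈ (Finset.range N).image (fun k : ℕ => z ^ k * h),
            lp.single p x ((N : ℂ)⁻¹ • a) := by
      rw [cesaro_apply, Finset.sum_image hinj.injOn]
      refine Finset.sum_congr rfl fun k _ => ?_
      rw [← of_smul_single, ← lp.single_smul]
    rw [hsum, lp.norm_sum_single hp0 (fun _ => (N : ℂ)⁻¹ • a), Finset.sum_const,
      Finset.card_image_of_injective _ hinj, Finset.card_range, nsmul_eq_mul, norm_smul, norm_inv,
      RCLike.norm_natCast]
  have hlim : Filter.Tendsto (fun N : ℕ => (N : ℝ) * ((N : ℝ)⁻¹ * ‖a‖) ^ p.toReal)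
      Filter.atTop (nhds 0) := by
    have h1 : Filter.Tendsto (fun N : ℕ => (N : ℝ) ^ (-(p.toReal - 1)) * ‖a‖ ^ p.toReal)
        Filter.atTop (nhds (0 * ‖a‖ ^ p.toReal)) :=
      ((tendsto_rpow_neg_atTop (sub_pos.mpr hp1)).comp tendsto_natCast_atTop_atTop).mul_const _
    rw [zero_mul] at h1
    refine h1.congr' ?_
    filter_upwards [Filter.eventually_gt_atTop 0] with N hN
    have hN' : (0 : ℝ) < N := Nat.cast_pos.mpr hN
    rw [Real.mul_rpow (inv_nonneg.mpr hN'.le) (norm_nonneg a), ← mul_assoc,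
      Real.inv_rpow hN'.le, ← Real.rpow_neg hN'.le, neg_sub, sub_eq_add_neg, Real.rpow_add hN',
      Real.rpow_one]
  rw [tendsto_zero_iff_norm_tendsto_zero]
  have h2 := hlim.rpow_const (p := p.toReal⁻¹) (Or.inr (inv_nonneg.mpr hp0.le))
  rw [Real.zero_rpow (inv_ne_zero hp0.ne')] at h2
  refine h2.congr fun N => ?_
  rw [← hnorm, Real.rpow_rpow_inv (norm_nonneg _) hp0.ne']

/-- A mean ergodic theorem: since `z` has infinite order, its Cesàro means tend strongly to `0`. -/
theorem tendsto_cesaro (hp_one : 1 < p) (hp_top : p ≠ ∞) (hz_order : ¬ IsOfFinOrder z)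
    (f : Lp G p) : Filter.Tendsto (fun N => cesaro p hz N f) Filter.atTop (nhds 0) := by
  classical
  rw [Metric.tendsto_atTop']
  intro ε hε
  -- Approximate `f` by a finitely supported function; the means are contractions, so they preserve
  -- the quality of the approximation.
  obtain ⟨s, hs⟩ := ((Metric.tendsto_nhds.mp (lp.hasSum_single hp_top f)) (ε / 2)
    (half_pos hε)).exists
  have hfin : Filter.Tendsto (fun N => cesaro p hz N (∑ x ∈ s, lp.single p x (f x)))
      Filter.atTop (nhds 0) := by
    simp only [map_sum]
    rw [← Finset.sum_const_zero (s := s)]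
    exact tendsto_finsetSum _ fun x _ => tendsto_cesaro_single hz hp_one hp_top hz_order x (f x)
  obtain ⟨N₀, hN₀⟩ := Metric.tendsto_atTop'.mp hfin (ε / 2) (half_pos hε)
  refine ⟨N₀, fun N hN => ?_⟩
  have h1 := hN₀ N hN
  have h2 := (norm_cesaro_le hz hp_top N (∑ x ∈ s, lp.single p x (f x) - f)).trans_lt
    (by rwa [dist_eq_norm] at hs)
  rw [map_sub, norm_sub_rev] at h2
  rw [dist_zero_right] at h1 ⊢
  linarith [norm_le_norm_add_norm_sub (cesaro p hz N (∑ x ∈ s, lp.single p x (f x)))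
    (cesaro p hz N f), norm_sub_rev (cesaro p hz N f)
      (cesaro p hz N (∑ x ∈ s, lp.single p x (f x)))]

end Cesaro

/-! ### Chains and change of coefficients -/

section Chains

variable {G : Type u} [Group G] {p : ℝ≥0∞}
  {F F' F'' : Type v} [AddCommGroup F] [Module (ZG G) F] [AddCommGroup F'] [Module (ZG G) F']
  [AddCommGroup F''] [Module (ZG G) F'']

variable (p) in
/-- The additive map `f ↦ x ⊗ f`. -/
def LpChain.tmulHom (x : F) : Lp G p →+ LpChain G p F :=
  (QuotientAddGroup.mk' (tensorRel G p F)).comp (TensorProduct.mk ℤ F (Lp G p) x).toAddMonoidHom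

@[simp]
theorem LpChain.tmulHom_apply (x : F) (f : Lp G p) : tmulHom p x f = tmul p x f := rfl

theorem LpChain.tmul_add_left (x y : F) (f : Lp G p) :
    tmul p (x + y) f = tmul p x f + tmul p y f := by
  rw [tmul, TensorProduct.add_tmul, map_add]
  rfl

theorem LpChain.of_smul_tmul (g : G) (x : F) (f : Lp G p) :
    tmul p (MonoidAlgebra.of ℤ G g⁻¹ • x) f = tmul p x (MonoidAlgebra.of ℤ G g • f) := by
  refine (QuotientAddGroup.eq_iff_sub_mem (N := tensorRel G p F)).mpr ?_
  exact AddSubgroup.subset_closure ⟨g, x, f, rfl⟩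

theorem LpChain.induction_on {motive : LpChain G p F → Prop} (c : LpChain G p F)
    (zero : motive 0) (tmul : ∀ x f, motive (tmul p x f))
    (add : ∀ a b, motive a → motive b → motive (a + b)) : motive c := by
  obtain ⟨t, rfl⟩ := QuotientAddGroup.mk'_surjective (tensorRel G p F) c
  induction t with
  | zero => exact zero
  | tmul x f => exact tmul x f
  | add a b ha hb => rw [map_add]; exact add _ _ ha hb

theorem LpChain.hom_ext {M : Type*} [AddCommGroup M] {a b : LpChain G p F →+ M}
    (h : ∀ x f, a (tmul p x f) = b (tmul p x f)) (c : LpChain G p F) : a c = b c := by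
  induction c using LpChain.induction_on with
  | zero => simp
  | tmul x f => exact h x f
  | add a b ha hb => rw [map_add, map_add, ha, hb]

variable (F) in
/-- The map `1 ⊗ T` on `F ⊗_{ℤ[G]} ℓ^p(G)` induced by an endomorphism `T` of `ℓ^p(G)`. -/
def LpChain.coeffMap (T : Lp G p →ₗ[ZG G] Lp G p) : LpChain G p F →+ LpChain G p F :=
  QuotientAddGroup.map (tensorRel G p F) (tensorRel G p F)
    (TensorProduct.map (LinearMap.id : F →ₗ[ℤ] F)
      T.toAddMonoidHom.toIntLinearMap).toAddMonoidHom
    (by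
      rw [tensorRel, AddSubgroup.closure_le]
      rintro _ ⟨g, x, f, rfl⟩
      refine AddSubgroup.subset_closure ⟨g, x, T f, ?_⟩
      simp)

@[simp]
theorem LpChain.coeffMap_tmul (T : Lp G p →ₗ[ZG G] Lp G p) (x : F) (f : Lp G p) :
    coeffMap F T (tmul p x f) = tmul p x (T f) := rfl

theorem LpChain.map_coeffMap (φ : F →ₗ[ZG G] F') (T : Lp G p →ₗ[ZG G] Lp G p)
    (c : LpChain G p F) : map p φ (coeffMap F T c) = coeffMap F' T (map p φ c) :=
  LpChain.hom_ext (a := (map p φ).comp (coeffMap F T)) (b := (coeffMap F' T).comp (map p φ))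
    (fun _ _ => rfl) c

theorem LpChain.map_map (φ : F →ₗ[ZG G] F') (ψ : F' →ₗ[ZG G] F'') (c : LpChain G p F) :
    map p ψ (map p φ c) = map p (ψ ∘ₗ φ) c :=
  LpChain.hom_ext (a := (map p ψ).comp (map p φ)) (b := map p (ψ ∘ₗ φ)) (fun _ _ => rfl) c

theorem LpChain.map_add (φ ψ : F →ₗ[ZG G] F') (c : LpChain G p F) :
    map p (φ + ψ) c = map p φ c + map p ψ c :=
  LpChain.hom_ext (a := map p (φ + ψ)) (b := map p φ + map p ψ)
    (fun x f => tmul_add_left (φ x) (ψ x) f) c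

theorem LpChain.map_id (c : LpChain G p F) : map p (LinearMap.id : F →ₗ[ZG G] F) c = c :=
  LpChain.hom_ext (a := map p LinearMap.id) (b := AddMonoidHom.id _) (fun _ _ => rfl) c

variable {z : G} (hz : z ∈ Subgroup.center G)

/-- On chains the Cesàro means are given by the action on the left factor, because
`x ⊗ g f = g⁻¹ x ⊗ f`.  The factor `N⁻¹` stays with the chain, since `F` has no complex scalars. -/
theorem LpChain.sub_coeffMap_cesaro {N : ℕ} (hN : N ≠ 0) (c : LpChain G p F) :
    c - coeffMap F (cesaro p hz N) c = ∑ k ∈ Finset.range N,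
      (coeffMap F (scalar G p (N : ℂ)⁻¹) c -
        map p (centralSMul (inv_mem (pow_mem hz k)) F) (coeffMap F (scalar G p (N : ℂ)⁻¹) c)) := by
  have hN' : (N : ℂ) ≠ 0 := Nat.cast_ne_zero.mpr hN
  have h1 : N • coeffMap F (scalar G p (N : ℂ)⁻¹) c = c :=
    LpChain.hom_ext (a := N • coeffMap F (scalar G p (N : ℂ)⁻¹)) (b := AddMonoidHom.id _)
      (fun x f => by
        change N • tmulHom p x ((N : ℂ)⁻¹ • f) = tmulHom p x f
        rw [← map_nsmul, ← Nat.cast_smul_eq_nsmul ℂ, smul_inv_smul₀ hN']) c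
  have h2 : coeffMap F (cesaro p hz N) c = ∑ k ∈ Finset.range N,
      map p (centralSMul (inv_mem (pow_mem hz k)) F)
        (coeffMap F (scalar G p (N : ℂ)⁻¹) c) := by
    have := LpChain.hom_ext (a := coeffMap F (cesaro p hz N))
      (b := ∑ k ∈ Finset.range N, (map p (centralSMul (inv_mem (pow_mem hz k)) F)).comp
        (coeffMap F (scalar G p (N : ℂ)⁻¹))) (fun x f => by
          rw [AddMonoidHom.finsetSum_apply, coeffMap_tmul, cesaro_apply, ← tmulHom_apply, map_sum]
          refine Finset.sum_congr rfl fun k _ => ?_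
          rw [AddMonoidHom.comp_apply, coeffMap_tmul, map_tmul, centralSMul_apply, of_smul_tmul]
          rfl) c
    rwa [AddMonoidHom.finsetSum_apply] at this
  rw [Finset.sum_sub_distrib, Finset.sum_const, Finset.card_range, h1, h2]

variable [Fact (1 ≤ p)]

theorem LpChain.continuous_tmul (x : F) : Continuous fun f : Lp G p => tmul p x f := by
  change @Continuous _ _ _ (LpChain.groupTopology p F).toTopologicalSpace _
  rw [LpChain.groupTopology, AddGroupTopology.toTopologicalSpace_sInf]
  refine continuous_sInf_rng.mpr ?_
  rintro _ ⟨t, ht, rfl⟩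
  exact ht x

theorem LpChain.tendsto_coeffMap_cesaro (hp_one : 1 < p) (hp_top : p ≠ ∞)
    (hz_order : ¬ IsOfFinOrder z) (c : LpChain G p F) :
    Filter.Tendsto (fun N => coeffMap F (cesaro p hz N) c) Filter.atTop (nhds 0) := by
  induction c using LpChain.induction_on with
  | zero => simpa only [map_zero] using tendsto_const_nhds
  | tmul x f =>
    have h := ((continuous_tmul (p := p) x).tendsto 0).comp
      (tendsto_cesaro hz hp_one hp_top hz_order f)
    rwa [← tmulHom_apply, map_zero] at h
  | add a b ha hb =>
    simp only [_root_.map_add]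
    simpa only [add_zero] using ha.add hb

end Chains

/-! ### Vanishing of the reduced homology and cohomology -/

section Vanishing

variable {G : Type u} [Group G] {p : ℝ≥0∞} {A : AugSeq.{u, v} G}

theorem LpChain.sub_map_eq_map {F : Type v} [AddCommGroup F] [Module (ZG G) F]
    {φ ψ : F →ₗ[ZG G] F} (h : ∀ x, φ x = x - ψ x) (c : LpChain G p F) :
    c - map p ψ c = map p φ c := by
  have hφ : φ + ψ = LinearMap.id := LinearMap.ext fun x => by simp [h]
  rw [sub_eq_iff_eq_add, ← LpChain.map_add, hφ, LpChain.map_id]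

/-- A central element acts trivially on the unreduced homology. -/
theorem sub_map_centralSMul_mem_boundaries (hA : A.IsProjectiveResolution) {w : G}
    (hw : w ∈ Subgroup.center G) {i : ℕ} {c : LpChain G p (A.F i)} (hc : c ∈ cycles A p i) :
    c - LpChain.map p (centralSMul hw _) c ∈ boundaries A p i := by
  cases i with
  | zero =>
    obtain ⟨h, hh⟩ := hA.exists_homotopy_zero hw
    refine ⟨LpChain.map p h c, ?_⟩
    rw [LpChain.map_map, LpChain.sub_map_eq_map (φ := A.d 0 ∘ₗ h) hh]
  | succ i =>
    obtain ⟨h, h', hh⟩ := hA.exists_homotopy_succ hw i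
    refine ⟨LpChain.map p h' c, ?_⟩
    have hc' : LpChain.map p (A.d i) c = 0 := hc
    rw [LpChain.sub_map_eq_map (φ := A.d (i + 1) ∘ₗ h' + h ∘ₗ A.d i) hh, LpChain.map_add,
      ← LpChain.map_map (A.d i) h, hc', map_zero, add_zero, LpChain.map_map]

theorem coeffMap_mem_cycles (T : Lp G p →ₗ[ZG G] Lp G p) {i : ℕ} {c : LpChain G p (A.F i)}
    (hc : c ∈ cycles A p i) : LpChain.coeffMap (A.F i) T c ∈ cycles A p i := by
  cases i with
  | zero => trivial
  | succ i =>
    have hc' : LpChain.map p (A.d i) c = 0 := hc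
    change LpChain.map p (A.d i) _ = 0
    rw [LpChain.map_coeffMap, hc', map_zero]

/-- A central element acts trivially on the unreduced cohomology. -/
theorem sub_comp_centralSMul_mem_coboundaries (hA : A.IsProjectiveResolution) {w : G}
    (hw : w ∈ Subgroup.center G) {i : ℕ} {φ : A.F i →ₗ[ZG G] Lp G p} (hφ : φ ∘ₗ A.d i = 0) :
    (φ - φ ∘ₗ centralSMul hw _ : A.F i →ₗ[ZG G] Lp G p) ∈ coboundaries A p i := by
  have hφ' (x : A.F (i + 1)) : φ (A.d i x) = 0 := LinearMap.congr_fun hφ x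
  cases i with
  | zero =>
    obtain ⟨h, hh⟩ := hA.exists_homotopy_zero hw
    refine AddSubgroup.mem_bot.mpr (LinearMap.ext fun x => ?_)
    change φ x - φ (centralSMul hw _ x) = 0
    rw [← map_sub, ← hh, hφ']
  | succ i =>
    obtain ⟨h, h', hh⟩ := hA.exists_homotopy_succ hw i
    refine ⟨φ ∘ₗ h, LinearMap.ext fun x => ?_⟩
    change φ (h (A.d i x)) = φ x - φ (centralSMul hw _ x)
    rw [← map_sub, ← hh, map_add, hφ', zero_add]

variable [Fact (1 ≤ p)] {z : G}

theorem cycles_le_closure_boundaries (hp_one : 1 < p) (hp_top : p ≠ ∞)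
    (hz : z ∈ Subgroup.center G) (hz_order : ¬ IsOfFinOrder z) (hA : A.IsProjectiveResolution)
    (i : ℕ) : cycles A p i ≤ (boundaries A p i).topologicalClosure := by
  intro c hc
  have hlim : Filter.Tendsto (fun N => c - LpChain.coeffMap (A.F i) (cesaro p hz N) c)
      Filter.atTop (nhds c) := by
    simpa only [sub_zero] using
      (LpChain.tendsto_coeffMap_cesaro hz hp_one hp_top hz_order c).const_sub c
  refine mem_closure_of_tendsto hlim ?_
  filter_upwards [Filter.eventually_ne_atTop 0] with N hN
  rw [LpChain.sub_coeffMap_cesaro hz hN]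
  exact sum_mem fun k _ => sub_map_centralSMul_mem_boundaries hA _ (coeffMap_mem_cycles _ hc)

theorem cocycles_le_closure_coboundaries (hp_one : 1 < p) (hp_top : p ≠ ∞)
    (hz : z ∈ Subgroup.center G) (hz_order : ¬ IsOfFinOrder z) (hA : A.IsProjectiveResolution)
    (i : ℕ) : cocycles A p i ≤ (coboundaries A p i).topologicalClosure := by
  intro (φ : A.F i →ₗ[ZG G] Lp G p) (hφ : φ ∘ₗ A.d i = 0)
  let ψ (N : ℕ) : LpCochain G p (A.F i) := φ - cesaro p hz N ∘ₗ φ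
  have hlim : Filter.Tendsto ψ Filter.atTop
      (nhds (show LpCochain G p (A.F i) from φ)) := by
    rw [nhds_induced, Filter.tendsto_comap_iff]
    refine tendsto_pi_nhds.mpr fun x => ?_
    change Filter.Tendsto (fun N => φ x - cesaro p hz N (φ x)) Filter.atTop (nhds (φ x))
    simpa only [sub_zero] using
      (tendsto_cesaro hz hp_one hp_top hz_order (φ x)).const_sub (φ x)
  refine mem_closure_of_tendsto hlim ?_
  filter_upwards [Filter.eventually_ne_atTop 0] with N hN
  -- The factor `N⁻¹` is moved into the cocycle, so that each summand is a coboundary.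
  let φ' : A.F i →ₗ[ZG G] Lp G p := scalar G p (N : ℂ)⁻¹ ∘ₗ φ
  have hφ' : φ' ∘ₗ A.d i = 0 := by rw [LinearMap.comp_assoc, hφ, LinearMap.comp_zero]
  have hψ : φ - cesaro p hz N ∘ₗ φ = ∑ k ∈ Finset.range N,
      (φ' - φ' ∘ₗ centralSMul (pow_mem hz k) (A.F i)) := by
    ext1 x
    have h1 : N • ((N : ℂ)⁻¹ • φ x) = φ x := by
      rw [← Nat.cast_smul_eq_nsmul ℂ, smul_inv_smul₀ (Nat.cast_ne_zero.mpr hN)]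
    rw [Finset.sum_sub_distrib, Finset.sum_const, Finset.card_range, LinearMap.sub_apply,
      LinearMap.sub_apply, LinearMap.sum_apply, LinearMap.comp_apply, cesaro_apply]
    congr 1
    · exact h1.symm
    · exact Finset.sum_congr rfl fun k _ => (map_smul φ' (MonoidAlgebra.of ℤ G (z ^ k)) x).symm
  change (φ - cesaro p hz N ∘ₗ φ : A.F i →ₗ[ZG G] Lp G p) ∈ coboundaries A p i
  rw [hψ]
  exact AddSubgroup.sum_mem (coboundaries A p i) fun k _ =>
    sub_comp_centralSMul_mem_coboundaries hA _ hφ'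

end Vanishing

end LpHomology

end

theorem mainTheorem3 (p : ℝ≥0∞) [Fact (1 ≤ p)] (hp_one : 1 < p) (hp_top : p ≠ ∞) (n : ℕ)
    (G : Type u) [Group G] (hG : LpHomology.IsTypeFP G n)
    (z : G) (hz : z ∈ Subgroup.center G) (hz_order : ¬ IsOfFinOrder z)
    (A : LpHomology.AugSeq.{u, v} G) (hA : A.IsProjectiveResolution)
    (hA_fin : A.IsFiniteTypeUpTo n) (i : ℕ) (hi : i ≤ n) :
    Subsingleton (LpHomology.ReducedHomology A p i) ∧
      Subsingleton (LpHomology.ReducedCohomology A p i) := by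
  constructor
  · rw [LpHomology.ReducedHomology, AddSubgroup.addSubgroupOf_eq_top.mpr
      (LpHomology.cycles_le_closure_boundaries hp_one hp_top hz hz_order hA i)]
    exact QuotientAddGroup.subsingleton_quotient_top
  · rw [LpHomology.ReducedCohomology, AddSubgroup.addSubgroupOf_eq_top.mpr
      (LpHomology.cocycles_le_closure_coboundaries hp_one hp_top hz hz_order hA i)]
    exact QuotientAddGroup.subsingleton_quotient_top
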